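/- Let $F$ be an algebraically closed field of characteristic $0$, let $n$ be a natural number, and let $M_n$ be the algebra of $n\times n$ matrices over $F$. Let $p$ be a commutative polynomial over $F$ in $n^2$ variables, regarded as a polynomial function of the entries of an $n\times n$ matrix, and let $U=D(p)=\{A\in M_n : p(A)\neq 0\}$. Suppose that $SAS^{-1}\in U$ and $\lambda A\in U$ for all $A\in U$, all invertible $S\in M_n$ and all nonzero $\lambda\in F$. Then there exist $m,d\ge 0$ and a noncommutative polynomial $f\in F\langle x_1,\dots,x_m\rangle$, homogeneous of degree $d$ (that is, a linear combination of words of length $d$ in $x_1,\dots,x_m$), such that $$\{f(a_1,\dots,a_m) : a_1,\dots,a_m\in M_n\}=U\cup\{0\}.$$ -/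

import Mathlib

/-- The standard (principal) Zariski-open set `D(p)` of `n × n` matrices at which the commutative
polynomial `p` in the `n²` matrix entries does not vanish. -/
def matrixD {F : Type*} [Field F] {n : ℕ} (p : MvPolynomial (Fin n × Fin n) F) :
    Set (Matrix (Fin n) (Fin n) F) :=
  {A | MvPolynomial.eval (fun ij : Fin n × Fin n => A ij.1 ij.2) p ≠ 0}

/-- A set of matrices is closed under conjugation by invertible matrices. -/
def ClosedUnderConj {F : Type*} [Field F] {n : ℕ} (U : Set (Matrix (Fin n) (Fin n) F)) : Prop :=
  ∀ (S : (Matrix (Fin n) (Fin n) F)ˣ), ∀ A ∈ U,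
    (S : Matrix (Fin n) (Fin n) F) * A * ((S⁻¹ : (Matrix (Fin n) (Fin n) F)ˣ) :
      Matrix (Fin n) (Fin n) F) ∈ U

/-- A set of matrices is closed under multiplication by nonzero scalars. -/
def ClosedUnderNonzeroSMul {F : Type*} [Field F] {n : ℕ}
    (U : Set (Matrix (Fin n) (Fin n) F)) : Prop :=
  ∀ (c : F), c ≠ 0 → ∀ A ∈ U, c • A ∈ U

/-- The word `x_{i₁} x_{i₂} ⋯ x_{i_k}` in the free algebra on `m` generators. -/
noncomputable def ncWord (F : Type*) [Field F] {m : ℕ} (l : List (Fin m)) : FreeAlgebra F (Fin m) :=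
  (l.map (FreeAlgebra.ι F)).prod

/-- A noncommutative polynomial is homogeneous of degree `d` if it is a linear combination of
words of length `d` (the zero polynomial is homogeneous of every degree). -/
def NCHomogeneous {F : Type*} [Field F] {m : ℕ} (d : ℕ) (f : FreeAlgebra F (Fin m)) : Prop :=
  f ∈ Submodule.span F (ncWord F '' {l : List (Fin m) | l.length = d})

/-- The image of a noncommutative polynomial on `n × n` matrices:
all values `f(a₁, …, a_m)`, where `a₁, …, a_m` are `n × n` matrices. -/
def ncImage {F : Type*} [Field F] (n : ℕ) {m : ℕ} (f : FreeAlgebra F (Fin m)) :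
    Set (Matrix (Fin n) (Fin n) F) :=
  Set.range fun a : Fin m → Matrix (Fin n) (Fin n) F => FreeAlgebra.lift F a f

open Matrix Polynomial

/-! The two closure properties of the nonvanishing locus pass to `p` itself: `p` is constant on
conjugacy classes (`conjInvariantBy_of_det_ne_zero`) and, if nonzero, homogeneous of some degree `k`
(`exists_isHomogeneous_of_closedUnderNonzeroSMul`). Both rest on the fact that a one-variable
polynomial over an algebraically closed field with no roots, or none except `0`, is a constant, or a
monomial.

A generic matrix is conjugate to its companion matrix, so `p` is a polynomial in the characteristic
coefficients (`exists_entryEval_eq_eval_charpoly_coeff`), hence in the traces of powers by Newton's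
identities in characteristic `0`. Razmyslov's identity (`sum_mul_mul_capelliGradient`) realizes `κ *
tr u` as a central noncommutative polynomial, where `κ` is a nonzero scalar function independent of
the variable `x`. Hence `κ ^ N * p(x)` is a homogeneous central polynomial for some `N`.

Take `f = κ ^ N * p(x) * x`. Its nonzero values are nonzero multiples of matrices in `U`.
Conversely, fixing `κ = w ≠ 0` and substituting `x = c • A` gives `w ^ N * c ^ (k + 1) * p(A) • A`,
and a suitable root `c` makes this equal to `A`. -/

/-- The value of a commutative polynomial at the entries of a square matrix. -/
noncomputable def entryEval {F : Type*} [Field F] {n : ℕ} (p : MvPolynomial (Fin n × Fin n) F)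
    (A : Matrix (Fin n) (Fin n) F) : F :=
  MvPolynomial.eval (fun ij : Fin n × Fin n => A ij.1 ij.2) p

lemma eval_aeval_polynomial {R σ : Type*} [CommRing R] (p : MvPolynomial σ R) (M : σ → R[X])
    (t : R) : (MvPolynomial.aeval M p).eval t = MvPolynomial.eval (fun i => (M i).eval t) p := by
  rw [← Polynomial.coe_evalRingHom, MvPolynomial.aeval_def, MvPolynomial.hom_eval₂,
    MvPolynomial.eval]
  congr 1
  ext r
  simp

/-- Over an algebraically closed field, a polynomial without zeros takes only one value. -/
lemma Polynomial.eval_eq_eval_of_forall_eval_ne_zero {K : Type*} [Field K] [IsAlgClosed K]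
    {f : K[X]} (hf : ∀ t, f.eval t ≠ 0) (s t : K) : f.eval s = f.eval t := by
  have hdeg : f.degree = 0 := by
    by_contra h
    obtain ⟨x, hx⟩ := IsAlgClosed.exists_root f h
    exact hf x hx
  rw [Polynomial.eq_C_of_degree_eq_zero hdeg]
  simp

/-- Over an algebraically closed field, a polynomial which is nonzero outside `0` is a monomial. -/
lemma Polynomial.coeff_eq_zero_or_of_forall_eval_ne_zero {K : Type*} [Field K] [IsAlgClosed K]
    {f : K[X]} (hf : ∀ t, t ≠ 0 → f.eval t ≠ 0) {i j : ℕ} (hij : i ≠ j) :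
    f.coeff i = 0 ∨ f.coeff j = 0 := by
  have hf0 : f ≠ 0 := by
    rintro rfl
    exact hf 1 one_ne_zero (by simp)
  -- After the full power of `X` is split off, the cofactor has no root at all and is therefore
  -- constant.
  obtain ⟨g, hg, hX⟩ := Polynomial.exists_eq_pow_rootMultiplicity_mul_and_not_dvd f hf0 0
  rw [C_0, sub_zero] at hg hX
  have hdeg : g.degree = 0 := by
    by_contra h
    obtain ⟨x, hx⟩ := IsAlgClosed.exists_root g h
    have hx0 : x ≠ 0 := by
      rintro rfl
      exact hX (Polynomial.X_dvd_iff.2 (by rw [Polynomial.coeff_zero_eq_eval_zero]; exact hx))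
    apply hf x hx0
    rw [hg, Polynomial.eval_mul, hx.eq_zero, mul_zero]
  rw [hg, Polynomial.eq_C_of_degree_eq_zero hdeg, mul_comm, Polynomial.coeff_C_mul_X_pow,
    Polynomial.coeff_C_mul_X_pow]
  by_cases hi : i = f.rootMultiplicity 0
  · exact Or.inr (if_neg fun hj => hij (hi.trans hj.symm))
  · exact Or.inl (if_neg hi)

/-! ### Conjugation invariance of `p` -/

section Invariance

variable {F : Type*} [Field F] {n : ℕ}

/-- `M` intertwines only matrices at which `p` takes the same value. -/
def ConjInvariantBy (p : MvPolynomial (Fin n × Fin n) F) (M : Matrix (Fin n) (Fin n) F) : Prop :=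
  ∀ A B : Matrix (Fin n) (Fin n) F, A * M = M * B → entryEval p A = entryEval p B

variable {p : MvPolynomial (Fin n × Fin n) F}

lemma ConjInvariantBy.mul {M N : Matrix (Fin n) (Fin n) F} (hM : ConjInvariantBy p M)
    (hN : ConjInvariantBy p N) (hdet : M.det ≠ 0) : ConjInvariantBy p (M * N) := by
  intro A B h
  have hu : IsUnit M.det := isUnit_iff_ne_zero.2 hdet
  have h1 : A * M = M * (M⁻¹ * A * M) := by
    rw [mul_assoc, Matrix.mul_nonsing_inv_cancel_left _ _ hu]
  refine (hM _ _ h1).trans (hN _ _ ?_)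
  rw [mul_assoc, mul_assoc, h, mul_assoc, Matrix.nonsing_inv_mul_cancel_left _ _ hu]

lemma ConjInvariantBy.one : ConjInvariantBy p 1 := by
  intro A B h
  rw [mul_one, one_mul] at h
  rw [h]

lemma ConjInvariantBy.smul {M : Matrix (Fin n) (Fin n) F} (hM : ConjInvariantBy p M) {c : F}
    (hc : c ≠ 0) : ConjInvariantBy p (c • M) := by
  intro A B h
  rw [Matrix.mul_smul, Matrix.smul_mul] at h
  exact hM A B (smul_right_injective _ hc h)

/-- Conjugating by the transvection with parameter `t` makes `p` a polynomial in `t`. If `p B ≠ 0`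
it has no roots, so its values at `c` and `0` agree; if `p B = 0`, closure under the inverse
conjugation forces `p A = 0`. -/
lemma conjInvariantBy_transvection [IsAlgClosed F] (hp : ClosedUnderConj (matrixD p))
    {i j : Fin n} (hij : i ≠ j) (c : F) : ConjInvariantBy p (transvection i j c) := by
  have hinv : ∀ t : F, transvection i j t * transvection i j (-t) = 1 := fun t => by
    rw [transvection_mul_transvection_same i j hij]; simp
  have hinv' : ∀ t : F, transvection i j (-t) * transvection i j t = 1 := fun t => by
    rw [transvection_mul_transvection_same i j hij]; simp
  set u : F → (Matrix (Fin n) (Fin n) F)ˣ := fun t =>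
    ⟨transvection i j t, transvection i j (-t), hinv t, hinv' t⟩
  have key : ∀ B : Matrix (Fin n) (Fin n) F, entryEval p B ≠ 0 →
      entryEval p (transvection i j c * B * transvection i j (-c)) = entryEval p B := by
    intro B hB
    let M : Matrix (Fin n) (Fin n) F[X] :=
      transvection i j X * B.map C * transvection i j (-X)
    let f : F[X] := MvPolynomial.aeval (fun ij : Fin n × Fin n => M ij.1 ij.2) p
    have hM : ∀ t, M.map (Polynomial.evalRingHom t) =
        transvection i j t * B * transvection i j (-t) := by
      intro t
      have h1 : (transvection i j X : Matrix (Fin n) (Fin n) F[X]).map (Polynomial.evalRingHom t)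
          = transvection i j t := by
        ext a b
        by_cases hab : i = a ∧ j = b <;> simp [transvection, Matrix.one_apply, Matrix.single, hab] <;>
          split_ifs <;> simp
      have h2 : (transvection i j (-X) : Matrix (Fin n) (Fin n) F[X]).map
          (Polynomial.evalRingHom t) = transvection i j (-t) := by
        ext a b
        by_cases hab : i = a ∧ j = b <;> simp [transvection, Matrix.one_apply, Matrix.single, hab] <;>
          split_ifs <;> simp
      have h3 : (B.map C).map (Polynomial.evalRingHom t) = B := by
        ext a b
        simp
      rw [Matrix.map_mul, Matrix.map_mul, h1, h2, h3]
    have hf : ∀ t, f.eval t = entryEval p (transvection i j t * B * transvection i j (-t)) := by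
      intro t
      rw [eval_aeval_polynomial, ← hM]
      rfl
    have hne : ∀ t, f.eval t ≠ 0 := by
      intro t
      rw [hf]
      exact hp (u t) B hB
    rw [← hf, Polynomial.eval_eq_eval_of_forall_eval_ne_zero hne c 0, hf]
    simp
  intro A B h
  have hA : A = transvection i j c * B * transvection i j (-c) := by
    rw [← h, mul_assoc, hinv, mul_one]
  by_cases hB : entryEval p B = 0
  · rw [hB]
    by_contra hA0
    have := hp (u c)⁻¹ A hA0
    apply this
    have h' : ((u c)⁻¹ : (Matrix (Fin n) (Fin n) F)ˣ) * A * (((u c)⁻¹)⁻¹ : (Matrix (Fin n) (Fin n) F)ˣ)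
        = B := by
      rw [inv_inv, mul_assoc, Units.inv_mul_eq_iff_eq_mul]
      exact h
    rw [h']
    exact hB
  · rw [hA, key B hB]

lemma diagonal_whitehead {i j : Fin n} (hij : i ≠ j) {t : F} (ht : t ≠ 0) :
    diagonal (Pi.mulSingle i t * Pi.mulSingle j t⁻¹ : Fin n → F) =
      transvection j i (-t⁻¹) * transvection i j (t - 1) * transvection j i 1 *
        transvection i j (t⁻¹ - 1) := by
  have hd : diagonal (Pi.mulSingle i t * Pi.mulSingle j t⁻¹ : Fin n → F) =
      1 + Matrix.single i i (t - 1) + Matrix.single j j (t⁻¹ - 1) := by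
    ext a b
    by_cases hab : a = b
    · subst hab
      by_cases hai : a = i
      · subst hai; simp [hij, Matrix.single, hij.symm]
      · by_cases haj : a = j
        · subst haj; simp [hij, Matrix.single, hij.symm]
        · simp [hai, haj, Matrix.single, Ne.symm hai, Ne.symm haj]
    · have h1 : ¬ (i = a ∧ i = b) := fun h => hab (h.1.symm.trans h.2)
      have h2 : ¬ (j = a ∧ j = b) := fun h => hab (h.1.symm.trans h.2)
      simp [hab, Matrix.single, h1, h2]
  rw [hd]
  simp only [transvection, mul_add, add_mul, mul_one, one_mul, Matrix.single_mul_single_same,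
    Matrix.single_mul_single_of_ne _ _ _ _ hij, Matrix.single_mul_single_of_ne _ _ _ _ hij.symm,
    Matrix.zero_mul]
  obtain ⟨e, he⟩ : ∃ e : Fin n → Fin n → Matrix (Fin n) (Fin n) F,
      ∀ a b c, Matrix.single a b c = c • e a b :=
    ⟨fun a b => Matrix.single a b 1, fun a b c => by rw [Matrix.smul_single, smul_eq_mul, mul_one]⟩
  simp only [he]
  have htt : t⁻¹ * t = 1 := inv_mul_cancel₀ ht
  match_scalars
  · ring
  · ring
  · linear_combination t⁻¹ * htt
  · linear_combination htt
  · linear_combination -htt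

lemma conjInvariantBy_diagonal_whitehead [IsAlgClosed F] (hp : ClosedUnderConj (matrixD p))
    {i j : Fin n} (hij : i ≠ j) {t : F} (ht : t ≠ 0) :
    ConjInvariantBy p (diagonal (Pi.mulSingle i t * Pi.mulSingle j t⁻¹ : Fin n → F)) := by
  rw [diagonal_whitehead hij ht]
  have h1 := conjInvariantBy_transvection hp hij
  have h2 := conjInvariantBy_transvection hp hij.symm
  refine (((h2 _).mul (h1 _) ?_).mul (h2 _) ?_).mul (h1 _) ?_ <;>
    simp only [Matrix.det_mul, det_transvection_of_ne _ _ hij, det_transvection_of_ne _ _ hij.symm,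
      mul_one, ne_eq, one_ne_zero, not_false_eq_true]

lemma conjInvariantBy_diagonal [IsAlgClosed F] (hp : ClosedUnderConj (matrixD p)) (j : Fin n)
    {d : Fin n → F} (hd : ∀ i, d i ≠ 0) : ConjInvariantBy p (diagonal d) := by
  have hn : 0 < n := j.pos
  -- Scalars act trivially by conjugation, so dividing by an `n`-th root of the determinant reduces
  -- to determinant `1`.
  obtain ⟨s, hs⟩ := IsAlgClosed.exists_pow_nat_eq (∏ i, d i) hn
  have hs0 : s ≠ 0 := by
    rintro rfl
    rw [zero_pow hn.ne'] at hs
    exact Finset.prod_ne_zero_iff.2 (fun i _ => hd i) hs.symm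
  set e : Fin n → F := fun i => s⁻¹ * d i with he
  have he0 : ∀ i, e i ≠ 0 := fun i => mul_ne_zero (inv_ne_zero hs0) (hd i)
  have hprod : ∏ i, e i = 1 := by
    simp only [he, Finset.prod_mul_distrib, Finset.prod_const, Finset.card_univ, Fintype.card_fin,
      ← hs, inv_pow]
    exact inv_mul_cancel₀ (pow_ne_zero _ hs0)
  have hde : diagonal d = s • diagonal e := by
    rw [← diagonal_smul]
    congr 1
    ext i
    simp [he, hs0]
  rw [hde]
  refine ConjInvariantBy.smul ?_ hs0
  -- Each slot `i ≠ j` is paired with slot `j`, which collects the inverses of the other entries;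
  -- that is `e j`, as the product is `1`.
  have hfac : e = ∏ i ∈ Finset.univ.erase j, (Pi.mulSingle i (e i) * Pi.mulSingle j (e i)⁻¹) := by
    ext a
    rw [Finset.prod_apply]
    simp only [Pi.mul_apply]
    rw [Finset.prod_mul_distrib]
    by_cases haj : a = j
    · subst haj
      have h1 : ∏ x ∈ Finset.univ.erase a, (Pi.mulSingle x (e x) : Fin n → F) a = 1 :=
        Finset.prod_eq_one fun x hx => by
          rw [Pi.mulSingle_eq_of_ne (Finset.ne_of_mem_erase hx).symm]
      rw [h1, one_mul]
      simp only [Pi.mulSingle_eq_same, Finset.prod_inv_distrib]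
      rw [← Finset.mul_prod_erase _ _ (Finset.mem_univ a)] at hprod
      exact eq_inv_of_mul_eq_one_left hprod
    · simp only [Pi.mulSingle_eq_of_ne haj, Finset.prod_const_one, mul_one]
      rw [Finset.prod_eq_single_of_mem a (by simp [haj])]
      · simp
      · intro b _ hb
        exact Pi.mulSingle_eq_of_ne hb.symm _
  rw [hfac]
  have hsub : ∀ i ∈ Finset.univ.erase j, i ≠ j := fun i hi => Finset.ne_of_mem_erase hi
  revert hsub
  generalize Finset.univ.erase j = T
  induction T using Finset.induction_on with
  | empty =>
    intro _
    rw [Finset.prod_empty]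
    exact (Matrix.diagonal_one (n := Fin n) (α := F)).symm ▸ ConjInvariantBy.one
  | insert i T hi ih =>
    intro hsub
    rw [Finset.prod_insert hi]
    have hij := hsub i (Finset.mem_insert_self _ _)
    have := (conjInvariantBy_diagonal_whitehead hp hij (he0 i)).mul
      (ih fun k hk => hsub k (Finset.mem_insert_of_mem hk)) (by
        rw [diagonal_whitehead hij (he0 i)]
        simp [det_transvection_of_ne, hij, hij.symm])
    rwa [diagonal_mul_diagonal'] at this

/-- A polynomial whose nonvanishing locus is closed under conjugation is a conjugation invariant. -/
lemma conjInvariantBy_of_det_ne_zero [IsAlgClosed F] (hp : ClosedUnderConj (matrixD p))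
    (j : Fin n) {M : Matrix (Fin n) (Fin n) F} (hM : M.det ≠ 0) : ConjInvariantBy p M := by
  refine Matrix.diagonal_transvection_induction_of_det_ne_zero (ConjInvariantBy p) M hM ?_ ?_ ?_
  · intro D hD
    rw [det_diagonal] at hD
    exact conjInvariantBy_diagonal hp j fun i => Finset.prod_ne_zero_iff.1 hD i (Finset.mem_univ i)
  · intro t
    exact conjInvariantBy_transvection hp t.hij t.c
  · intro A B hA _ h1 h2
    exact h1.mul h2 hA

end Invariance

/-! ### Homogeneity of `p` -/

section Homogeneity

variable {F : Type*} [Field F] [IsAlgClosed F] {n : ℕ}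

lemma MvPolynomial.IsHomogeneous.eval_const_mul {R σ : Type*} [CommRing R]
    {p : MvPolynomial σ R} {d : ℕ} (hp : p.IsHomogeneous d) (c : R) (x : σ → R) :
    MvPolynomial.eval (fun i => c * x i) p = c ^ d * MvPolynomial.eval x p := by
  rw [MvPolynomial.eval_eq, MvPolynomial.eval_eq, Finset.mul_sum]
  refine Finset.sum_congr rfl fun m hm => ?_
  have hd : ∑ i ∈ m.support, m i = d := by
    rw [← hp (MvPolynomial.mem_support_iff.1 hm), show (Finsupp.weight (1 : σ → ℕ)) m = m.degree from
      (DFunLike.congr_fun Finsupp.degree_eq_weight_one m).symm, Finsupp.degree_apply]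
  simp only [mul_pow, Finset.prod_mul_distrib, Finset.prod_pow_eq_pow_sum, hd]
  ring

/-- A nonzero polynomial whose nonvanishing locus is closed under nonzero scalars is
homogeneous. -/
lemma exists_isHomogeneous_of_closedUnderNonzeroSMul {p : MvPolynomial (Fin n × Fin n) F}
    (hp : ClosedUnderNonzeroSMul (matrixD p)) (hp0 : p ≠ 0) : ∃ k, p.IsHomogeneous k := by
  classical
  set q : ℕ → MvPolynomial (Fin n × Fin n) F := fun d => MvPolynomial.homogeneousComponent d p
    with hq
  set s := Finset.range (p.totalDegree + 1)
  have hsum : ∑ d ∈ s, q d = p := MvPolynomial.sum_homogeneousComponent p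
  have key : ∀ i ∈ s, ∀ j ∈ s, i ≠ j → q i = 0 ∨ q j = 0 := by
    intro i hi j hj hij
    -- Where `p x ≠ 0`, the polynomial `t ↦ p (t x)` is a monomial, so two components cannot both be
    -- nonzero at `x`. The factor `p` covers the other points.
    have hzero : p * (q i * q j) = 0 := by
      apply MvPolynomial.funext
      intro x
      rw [map_mul, map_zero, map_mul, mul_eq_zero, mul_eq_zero]
      by_cases hx : MvPolynomial.eval x p = 0
      · exact Or.inl hx
      right
      let f : F[X] := ∑ d ∈ s, Polynomial.C (MvPolynomial.eval x (q d)) * Polynomial.X ^ d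
      have hfe : ∀ t, f.eval t = MvPolynomial.eval (fun i => t * x i) p := by
        intro t
        conv_rhs => rw [← hsum, map_sum]
        rw [Polynomial.eval_finsetSum]
        refine Finset.sum_congr rfl fun d _ => ?_
        rw [(MvPolynomial.homogeneousComponent_isHomogeneous d p).eval_const_mul]
        simp only [Polynomial.eval_mul, Polynomial.eval_C, Polynomial.eval_pow, Polynomial.eval_X]
        exact mul_comm _ _
      have hfc : ∀ d ∈ s, f.coeff d = MvPolynomial.eval x (q d) := by
        intro d hd
        simp only [f, Polynomial.finsetSum_coeff, Polynomial.coeff_C_mul_X_pow]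
        rw [Finset.sum_ite_eq, if_pos hd]
      rw [← hfc i hi, ← hfc j hj]
      refine Polynomial.coeff_eq_zero_or_of_forall_eval_ne_zero ?_ hij
      intro t ht
      rw [hfe]
      exact hp t ht (Matrix.of fun i j => x (i, j)) hx
    exact mul_eq_zero.1 ((mul_eq_zero.1 hzero).resolve_left hp0)
  obtain ⟨k, hk, hk0⟩ : ∃ k ∈ s, q k ≠ 0 := by
    by_contra! h
    exact hp0 (hsum ▸ Finset.sum_eq_zero h)
  refine ⟨k, ?_⟩
  rw [← hsum, Finset.sum_eq_single_of_mem k hk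
    fun d hd hdk => (key d hd k hk hdk).resolve_right hk0]
  exact MvPolynomial.homogeneousComponent_isHomogeneous k p

end Homogeneity

/-! ### Companion and Krylov matrices -/

section Companion

variable {R : Type*} [CommRing R] {n : ℕ}

/-- The companion matrix of the monic polynomial of degree `n` with lower coefficients `c`. -/
def companionMatrix (c : Fin n → R) : Matrix (Fin n) (Fin n) R :=
  Matrix.of fun i j => if (j : ℕ) + 1 = n then -c i else if (i : ℕ) = j + 1 then 1 else 0

/-- The matrix with columns `e₀, A e₀, A² e₀, …`. -/
def krylovMatrix [NeZero n] (A : Matrix (Fin n) (Fin n) R) : Matrix (Fin n) (Fin n) R :=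
  Matrix.of fun i j => (A ^ (j : ℕ)) i 0

/-- Multiplication by `A` shifts the Krylov columns; Cayley–Hamilton gives the last one. No
cyclicity is needed until the Krylov matrix is inverted. -/
lemma mul_krylovMatrix [NeZero n] (A : Matrix (Fin n) (Fin n) R) :
    A * krylovMatrix A = krylovMatrix A * companionMatrix fun i : Fin n => A.charpoly.coeff i := by
  nontriviality R
  ext i j
  have hl : (A * krylovMatrix A) i j = (A ^ ((j : ℕ) + 1)) i 0 := by
    rw [pow_succ', Matrix.mul_apply, Matrix.mul_apply]
    rfl
  rw [hl, Matrix.mul_apply]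
  simp only [krylovMatrix, companionMatrix, Matrix.of_apply]
  by_cases hj : (j : ℕ) + 1 = n
  · simp only [hj, if_true]
    have hCH := Matrix.aeval_self_charpoly A
    rw [Polynomial.aeval_eq_sum_range, Matrix.charpoly_natDegree_eq_dim, Fintype.card_fin,
      Finset.sum_range_succ] at hCH
    have hlead : A.charpoly.coeff n = 1 := by
      have := A.charpoly_monic.coeff_natDegree
      rwa [Matrix.charpoly_natDegree_eq_dim, Fintype.card_fin] at this
    rw [hlead, one_smul, ← Fin.sum_univ_eq_sum_range (fun l => A.charpoly.coeff l • A ^ l)] at hCH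
    have h0 := congrFun (congrFun hCH i) 0
    rw [Matrix.add_apply, Matrix.sum_apply, Matrix.zero_apply] at h0
    rw [eq_neg_of_add_eq_zero_right h0, ← Finset.sum_neg_distrib]
    refine Finset.sum_congr rfl fun l _ => ?_
    rw [Matrix.smul_apply, smul_eq_mul]
    ring
  · simp only [hj, if_false]
    have hlt : (j : ℕ) + 1 < n := by omega
    rw [Finset.sum_eq_single (⟨(j : ℕ) + 1, hlt⟩ : Fin n)]
    · simp
    · intro b _ hb
      rw [if_neg fun h => hb (Fin.ext h), mul_zero]
    · simp

lemma krylovMatrix_map [NeZero n] {S : Type*} [CommRing S] (f : R →+* S)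
    (A : Matrix (Fin n) (Fin n) R) : (krylovMatrix A).map f = krylovMatrix (A.map f) := by
  ext i j
  simp only [krylovMatrix, Matrix.map_apply, Matrix.of_apply, ← Matrix.map_pow]

/-- The lower shift matrix has the standard basis as its Krylov basis. -/
lemma krylovMatrix_companionMatrix_zero [NeZero n] :
    krylovMatrix (companionMatrix (0 : Fin n → R)) = 1 := by
  have h : ∀ k : ℕ, k < n → ∀ i : Fin n,
      ((companionMatrix (0 : Fin n → R)) ^ k) i 0 = if (i : ℕ) = k then 1 else 0 := by
    intro k
    induction k with
    | zero =>
      intro _ i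
      rw [pow_zero, Matrix.one_apply]
      simp only [Fin.ext_iff, Fin.val_zero]
    | succ k ih =>
      intro hk i
      rw [pow_succ', Matrix.mul_apply]
      simp only [ih (by omega)]
      rw [Finset.sum_eq_single (⟨k, by omega⟩ : Fin n)]
      · simp only [companionMatrix, Matrix.of_apply, if_neg hk.ne, if_true, mul_one]
      · intro b _ hb
        rw [if_neg fun h => hb (Fin.ext h), mul_zero]
      · simp
  ext i j
  simp [krylovMatrix, h j j.2, Matrix.one_apply, Fin.ext_iff]

end Companion

/-! ### Invariants as polynomials in the characteristic coefficients -/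

section CharpolyCoeff

variable {F : Type*} [Field F] [IsAlgClosed F] {n : ℕ}

/-- A conjugation invariant polynomial is a polynomial in the coefficients of the characteristic
polynomial. -/
lemma exists_entryEval_eq_eval_charpoly_coeff [NeZero n] {p : MvPolynomial (Fin n × Fin n) F}
    (hp : ClosedUnderConj (matrixD p)) : ∃ q : MvPolynomial (Fin n) F,
      ∀ A, entryEval p A = MvPolynomial.eval (fun i : Fin n => A.charpoly.coeff i) q := by
  let q : MvPolynomial (Fin n) F := MvPolynomial.aeval
    (fun ij : Fin n × Fin n => companionMatrix (MvPolynomial.X (R := F)) ij.1 ij.2) p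
  have hq : ∀ c : Fin n → F, MvPolynomial.eval c q = entryEval p (companionMatrix c) := by
    intro c
    simp only [q, entryEval, MvPolynomial.aeval_def]
    rw [MvPolynomial.hom_eval₂, MvPolynomial.eval]
    congr 1
    · ext r; simp
    · funext ij
      simp only [companionMatrix, Matrix.of_apply]
      split_ifs <;> simp
  let Y := Matrix.mvPolynomialX (Fin n) (Fin n) F
  let q' : MvPolynomial (Fin n × Fin n) F :=
    MvPolynomial.aeval (fun i : Fin n => Y.charpoly.coeff i) q
  have hX : ∀ A : Matrix (Fin n) (Fin n) F,
      Y.map (MvPolynomial.eval fun ij : Fin n × Fin n => A ij.1 ij.2) = A := by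
    intro A
    ext i j
    simp [Y]
  have hq' : ∀ A, entryEval q' A = entryEval p (companionMatrix fun i : Fin n => A.charpoly.coeff i) := by
    intro A
    rw [← hq]
    simp only [q', entryEval, MvPolynomial.aeval_def]
    rw [MvPolynomial.hom_eval₂, MvPolynomial.eval]
    congr 1
    · ext r; simp
    · funext i
      conv_rhs => rw [← hX A, Matrix.charpoly_map, Polynomial.coeff_map]
      rfl
  -- The two polynomials agree wherever `e₀` is a cyclic vector, since there the Krylov matrix
  -- conjugates `A` to its companion matrix.
  have hzero : (p - q') * (krylovMatrix Y).det = 0 := by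
    apply MvPolynomial.funext
    intro x
    rw [map_mul, map_zero, mul_eq_zero, map_sub, sub_eq_zero, or_iff_not_imp_right]
    intro hdet
    set A : Matrix (Fin n) (Fin n) F := Matrix.of fun i j => x (i, j) with hA
    have hx : x = fun ij : Fin n × Fin n => A ij.1 ij.2 := rfl
    rw [RingHom.map_det, RingHom.mapMatrix_apply, krylovMatrix_map, hx, hX] at hdet
    change entryEval p A = entryEval q' A
    rw [hq']
    exact conjInvariantBy_of_det_ne_zero hp 0 hdet _ _ (mul_krylovMatrix A)
  have hdet0 : (krylovMatrix Y).det ≠ 0 := by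
    intro h
    have := congrArg (MvPolynomial.eval fun ij : Fin n × Fin n =>
      companionMatrix (0 : Fin n → F) ij.1 ij.2) h
    rw [RingHom.map_det, RingHom.mapMatrix_apply, krylovMatrix_map, hX,
      krylovMatrix_companionMatrix_zero, Matrix.det_one, map_zero] at this
    exact one_ne_zero this
  have hpq : p = q' := sub_eq_zero.1 ((mul_eq_zero.1 hzero).resolve_right hdet0)
  refine ⟨q, fun A => ?_⟩
  rw [hq, ← hq', ← hpq]

end CharpolyCoeff

/-! ### Newton's identities -/

section Newton

variable {R : Type*} [CommRing R] {n : Type*} [Fintype n] [DecidableEq n]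

/-- Jacobi's formula for the characteristic matrix. -/
lemma derivative_charpoly_eq_trace_adjugate (A : Matrix n n R) :
    derivative A.charpoly = (adjugate A.charmatrix).trace := by
  rw [Matrix.charpoly, Matrix.det_apply', Polynomial.derivative_sum]
  simp only [Matrix.trace, Matrix.diag_apply, Matrix.adjugate_apply, Matrix.det_apply']
  rw [Finset.sum_comm]
  refine Finset.sum_congr rfl fun σ _ => ?_
  have hz : derivative (((Equiv.Perm.sign σ : ℤ)) : R[X]) = 0 := by simp
  rw [Polynomial.derivative_mul, hz, zero_mul, zero_add, Polynomial.derivative_prod_finset,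
    Finset.mul_sum]
  -- The factor in column `i` lies in row `σ i`; reindexing by `σ` matches its derivative with the
  -- replaced row.
  rw [← Equiv.sum_comp σ fun i => ((Equiv.Perm.sign σ : ℤ) : R[X]) *
    ∏ j, (A.charmatrix.updateRow i (Pi.single i 1)) (σ j) j]
  refine Finset.sum_congr rfl fun i _ => ?_
  rw [← Finset.prod_erase_mul _ _ (Finset.mem_univ i)]
  congr 2
  · refine Finset.prod_congr rfl fun j hj => ?_
    rw [Matrix.updateRow_ne (σ.injective.ne (Finset.ne_of_mem_erase hj))]
  · rw [Matrix.updateRow_self, Matrix.charmatrix_apply]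
    by_cases h : σ i = i
    · simp [h]
    · simp [h]

/-- Newton's identities for the coefficients of the characteristic polynomial. -/
lemma card_sub_mul_charpoly_coeff (A : Matrix n n R) (j : ℕ) :
    ((Fintype.card n : R) - j) * A.charpoly.coeff j =
      -∑ i ∈ Finset.range (Fintype.card n), A.charpoly.coeff (j + i + 1) * (A ^ (i + 1)).trace := by
  nontriviality R
  set N := Fintype.card n
  set χ := A.charpoly
  set B := matPolyEquiv (adjugate A.charmatrix)
  have hAB : (X - C A) * B = matPolyEquiv (Matrix.scalar n χ) := by
    rw [← Matrix.matPolyEquiv_charmatrix, ← map_mul, Matrix.mul_adjugate]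
    congr 1
    exact (Matrix.smul_one_eq_diagonal _)
  have hscal : ∀ k, (matPolyEquiv (Matrix.scalar n χ)).coeff k = Matrix.scalar n (χ.coeff k) := by
    intro k
    ext a b
    rw [matPolyEquiv_coeff_apply]
    by_cases hab : a = b <;> simp [hab]
  have htr : ∀ k, (B.coeff k).trace = (k + 1) * χ.coeff (k + 1) := by
    intro k
    have := congrArg (fun f => coeff f k) (derivative_charpoly_eq_trace_adjugate A)
    simp only [Polynomial.coeff_derivative] at this
    rw [mul_comm, this, Matrix.trace, Matrix.trace, Polynomial.finsetSum_coeff]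
    refine Finset.sum_congr rfl fun a _ => ?_
    rw [Matrix.diag_apply, Matrix.diag_apply, matPolyEquiv_coeff_apply]
  have h0 : -(A * B.coeff 0) = Matrix.scalar n (χ.coeff 0) := by
    rw [← hscal, ← hAB]
    simp [sub_mul]
  have hstep : ∀ k, B.coeff k = A * B.coeff (k + 1) + Matrix.scalar n (χ.coeff (k + 1)) := by
    intro k
    rw [← hscal, ← hAB]
    simp [sub_mul]
  -- Iterating the coefficient recursion of `(X - A) * adj (X - A) = χ`; for large `L` the remainder
  -- vanishes.
  have hchain : ∀ L k, B.coeff k = A ^ L * B.coeff (k + L) +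
      ∑ i ∈ Finset.range L, χ.coeff (k + i + 1) • A ^ i := by
    intro L
    induction L with
    | zero => intro k; simp
    | succ L ih =>
      intro k
      have hc : A ^ L * (Matrix.scalar n) (χ.coeff (k + L + 1)) = χ.coeff (k + L + 1) • A ^ L := by
        rw [Matrix.scalar_apply, ← Matrix.smul_one_eq_diagonal, Matrix.mul_smul, mul_one]
      rw [ih k, hstep (k + L), Finset.sum_range_succ, mul_add, ← mul_assoc, ← pow_succ, hc,
        ← add_assoc k L 1]
      abel
  have hvan : ∀ L k, B.natDegree < L → B.coeff (k + L) = 0 := fun L k h =>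
    Polynomial.coeff_eq_zero_of_natDegree_lt (by omega)
  have hsum : ∀ D, ∑ i ∈ Finset.range N, χ.coeff (j + i + 1) * (A ^ (i + 1)).trace =
      ∑ i ∈ Finset.range (N + D), χ.coeff (j + i + 1) * (A ^ (i + 1)).trace := by
    intro D
    refine Finset.sum_subset (Finset.range_mono (by omega)) fun i _ hi => ?_
    rw [Polynomial.coeff_eq_zero_of_natDegree_lt, zero_mul]
    rw [Matrix.charpoly_natDegree_eq_dim]
    simp only [Finset.mem_range, not_lt] at hi
    omega
  rw [hsum (B.natDegree + 1)]
  have htrone : (A ^ 0).trace = (N : R) := by rw [pow_zero, Matrix.trace_one]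
  cases j with
  | zero =>
    have h1 := congrArg Matrix.trace h0
    rw [hchain (N + (B.natDegree + 1)) 0, hvan _ _ (by omega), mul_zero, zero_add, Finset.mul_sum,
      Matrix.trace_neg, Matrix.trace_sum, Matrix.scalar_apply, Matrix.trace_diagonal,
      Finset.sum_const, Finset.card_univ, nsmul_eq_mul] at h1
    rw [Nat.cast_zero, sub_zero, ← h1]
    refine congrArg Neg.neg (Finset.sum_congr rfl fun i _ => ?_)
    rw [Matrix.mul_smul, Matrix.trace_smul, smul_eq_mul, pow_succ']
  | succ k =>
    have h1 := htr k
    rw [hchain (N + (B.natDegree + 1) + 1) k, hvan _ _ (by omega), mul_zero, zero_add,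
      Matrix.trace_sum, Finset.sum_range_succ'] at h1
    simp only [Matrix.trace_smul, smul_eq_mul, htrone] at h1
    have h2 : ∀ i, k + 1 + i + 1 = k + (i + 1) + 1 := fun i => by omega
    simp only [h2]
    push_cast
    linear_combination h1

end Newton

/-! ### Functions given by homogeneous noncommutative polynomials -/

section HomFun

variable {F : Type*} [Field F] {n m : ℕ}

lemma NCHomogeneous.mul {d e : ℕ} {f g : FreeAlgebra F (Fin m)} (hf : NCHomogeneous d f)
    (hg : NCHomogeneous e g) : NCHomogeneous (d + e) (f * g) := by
  have h := Submodule.mul_mem_mul hf hg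
  rw [Submodule.span_mul_span] at h
  refine Submodule.span_mono ?_ h
  rintro _ ⟨_, ⟨l, hl, rfl⟩, _, ⟨l', hl', rfl⟩, rfl⟩
  refine ⟨l ++ l', ?_, ?_⟩
  · simp only [Set.mem_ofPred_eq] at hl hl' ⊢
    rw [List.length_append, hl, hl']
  · simp [ncWord]

/-- The matrix valued function `φ` is given by a noncommutative polynomial which is homogeneous of
degree `d`. -/
def IsHomFun (d : ℕ) (φ : (Fin m → Matrix (Fin n) (Fin n) F) → Matrix (Fin n) (Fin n) F) : Prop :=
  ∃ f : FreeAlgebra F (Fin m), NCHomogeneous d f ∧ ∀ a, FreeAlgebra.lift F a f = φ a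

namespace IsHomFun

variable {d e : ℕ} {φ ψ : (Fin m → Matrix (Fin n) (Fin n) F) → Matrix (Fin n) (Fin n) F}

lemma congr_deg (h : IsHomFun d φ) (hd : d = e) : IsHomFun e φ := hd ▸ h

lemma zero : IsHomFun d (fun _ => 0 : (Fin m → Matrix (Fin n) (Fin n) F) → _) :=
  ⟨0, Submodule.zero_mem _, fun _ => map_zero _⟩

lemma one : IsHomFun 0 (fun _ => 1 : (Fin m → Matrix (Fin n) (Fin n) F) → _) :=
  ⟨1, Submodule.subset_span ⟨[], rfl, rfl⟩, fun _ => map_one _⟩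

lemma var (i : Fin m) : IsHomFun 1 (fun a : Fin m → Matrix (Fin n) (Fin n) F => a i) :=
  ⟨FreeAlgebra.ι F i, Submodule.subset_span ⟨[i], rfl, by simp [ncWord]⟩, fun _ => by simp⟩

lemma add (hφ : IsHomFun d φ) (hψ : IsHomFun d ψ) : IsHomFun d (fun a => φ a + ψ a) := by
  obtain ⟨f, hf, hf'⟩ := hφ
  obtain ⟨g, hg, hg'⟩ := hψ
  exact ⟨f + g, Submodule.add_mem _ hf hg, fun a => by rw [map_add, hf', hg']⟩

lemma smul (c : F) (hφ : IsHomFun d φ) : IsHomFun d (fun a => c • φ a) := by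
  obtain ⟨f, hf, hf'⟩ := hφ
  exact ⟨c • f, Submodule.smul_mem _ c hf, fun a => by rw [map_smul, hf']⟩

lemma mul (hφ : IsHomFun d φ) (hψ : IsHomFun e ψ) : IsHomFun (d + e) (fun a => φ a * ψ a) := by
  obtain ⟨f, hf, hf'⟩ := hφ
  obtain ⟨g, hg, hg'⟩ := hψ
  exact ⟨f * g, hf.mul hg, fun a => by rw [map_mul, hf', hg']⟩

lemma pow (hφ : IsHomFun d φ) (k : ℕ) : IsHomFun (k * d) (fun a => φ a ^ k) := by
  induction k with
  | zero => simpa using one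
  | succ k ih =>
    simp only [pow_succ]
    exact (ih.mul hφ).congr_deg (by ring)

lemma sum {ι : Type*} (s : Finset ι)
    {φ : ι → (Fin m → Matrix (Fin n) (Fin n) F) → Matrix (Fin n) (Fin n) F}
    (h : ∀ i ∈ s, IsHomFun d (φ i)) : IsHomFun d (fun a => ∑ i ∈ s, φ i a) := by
  classical
  induction s using Finset.induction_on with
  | empty => simpa using zero
  | insert i s hi ih =>
    simp only [Finset.sum_insert hi]
    exact (h i (Finset.mem_insert_self _ _)).add
      (ih fun j hj => h j (Finset.mem_insert_of_mem hj))

lemma list_prod {ι : Type*} (l : List ι)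
    {φ : ι → (Fin m → Matrix (Fin n) (Fin n) F) → Matrix (Fin n) (Fin n) F}
    (h : ∀ i, IsHomFun d (φ i)) : IsHomFun (l.length * d) (fun a => (l.map fun i => φ i a).prod) := by
  induction l with
  | nil => simpa using one
  | cons i l ih =>
    simp only [List.map_cons, List.prod_cons, List.length_cons]
    exact ((h i).mul ih).congr_deg (by ring)

end IsHomFun

end HomFun

/-! ### Cramer's rule for alternating forms -/

section Cramer

/-- Cramer's rule for an alternating form of top degree. -/
lemma AlternatingMap.smul_eq_sum_update_smul {F M ι : Type*} [Field F] [AddCommGroup M] [Module F M]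
    [Fintype ι] [DecidableEq ι] (b : Module.Basis ι F M) (Φ : M [⋀^ι]→ₗ[F] F) (y : ι → M) (w : M) :
    Φ y • w = ∑ i, Φ (Function.update y i w) • y i := by
  have hdet : b.det y • w = ∑ i, b.det (Function.update y i w) • y i := by
    apply b.repr.injective
    ext j
    have h := congrFun (Matrix.mulVec_cramer (b.toMatrix y) (b.repr w)) j
    rw [map_smul, map_sum, Finsupp.finsetSum_apply]
    simp only [Matrix.mulVec, dotProduct, Matrix.cramer_apply, Pi.smul_apply] at h
    rw [Finsupp.smul_apply, Module.Basis.det_apply, ← h]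
    refine Finset.sum_congr rfl fun i _ => ?_
    rw [map_smul, Finsupp.smul_apply, Module.Basis.det_apply, Module.Basis.toMatrix_update, smul_eq_mul,
      mul_comm]
    rfl
  rw [AlternatingMap.eq_smul_basis_det b Φ]
  simp only [AlternatingMap.smul_apply, smul_eq_mul, mul_smul, hdet, Finset.smul_sum]

end Cramer

/-! ### Razmyslov's central polynomial -/

section Razmyslov

variable {F : Type*} [Field F] {n r : ℕ}

local notation "𝕄" => Matrix (Fin n) (Fin n) F

/-- The alternating form `y ↦ ∑ σ, sign σ * tr (∏ₖ zₖ y_{σ k} z'ₖ)`. -/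
noncomputable def capelliForm (z z' : Fin r → 𝕄) : 𝕄 [⋀^Fin r]→ₗ[F] F :=
  MultilinearMap.alternatization
    ((Matrix.traceLinearMap (Fin n) F F).compMultilinearMap
      ((MultilinearMap.mkPiAlgebraFin F r 𝕄).compLinearMap
        fun k => LinearMap.mulLeft F (z k) ∘ₗ LinearMap.mulRight F (z' k)))

lemma capelliForm_apply (z z' y : Fin r → 𝕄) : capelliForm z z' y =
    ∑ σ : Equiv.Perm (Fin r), Equiv.Perm.sign σ •
      (List.ofFn fun k => z k * y (σ k) * z' k).prod.trace := by
  rw [capelliForm, MultilinearMap.alternatization_apply]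
  refine Finset.sum_congr rfl fun σ _ => ?_
  simp [mul_assoc]

/-- The gradient of `capelliForm z z'` in the `i`-th argument with respect to the trace form. -/
noncomputable def capelliGradient (z z' y : Fin r → 𝕄) (i : Fin r) : 𝕄 :=
  ∑ σ : Equiv.Perm (Fin r), ((Equiv.Perm.sign σ : ℤ) : F) •
    (z' (σ.symm i) *
      (((List.finRange r).drop ((σ.symm i : ℕ) + 1)).map fun k => z k * y (σ k) * z' k).prod *
      (((List.finRange r).take (σ.symm i : ℕ)).map fun k => z k * y (σ k) * z' k).prod *
      z (σ.symm i))

lemma List.prod_ofFn_update {A : Type*} [Monoid A] (g : Fin r → A) (k : Fin r) (x : A) :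
    (List.ofFn (Function.update g k x)).prod =
      (((List.finRange r).take k).map g).prod * x *
        (((List.finRange r).drop ((k : ℕ) + 1)).map g).prod := by
  have h : List.ofFn (Function.update g k x) = ((List.finRange r).map g).set k x := by
    apply List.ext_getElem
    · simp
    · intro j h1 h2
      rw [List.getElem_set]
      by_cases hj : (k : ℕ) = j
      · subst hj
        simp
      · rw [List.getElem_ofFn, if_neg hj, Function.update_of_ne]
        · simp
        · intro h
          exact hj (congrArg Fin.val h).symm
  rw [h, List.prod_set, List.map_take, List.map_drop]
  simp

/-- In each summand, cyclicity of the trace moves `w` to the front; the rest of the word is the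
gradient. -/
lemma capelliForm_update (z z' y : Fin r → 𝕄) (i : Fin r) (w : 𝕄) :
    capelliForm z z' (Function.update y i w) = (w * capelliGradient z z' y i).trace := by
  rw [capelliForm_apply, capelliGradient, Finset.mul_sum, Matrix.trace_sum]
  refine Finset.sum_congr rfl fun σ _ => ?_
  have h : (fun k => z k * (Function.update y i w) (σ k) * z' k) =
      Function.update (fun k => z k * y (σ k) * z' k) (σ.symm i)
        (z (σ.symm i) * w * z' (σ.symm i)) := by
    funext k
    by_cases hk : k = σ.symm i
    · subst hk
      simp
    · have : σ k ≠ i := fun h => hk ((Equiv.eq_symm_apply σ).2 h)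
      rw [Function.update_of_ne hk, Function.update_of_ne this]
  rw [h, List.prod_ofFn_update, Matrix.mul_smul, Matrix.trace_smul, Units.smul_def,
    zsmul_eq_mul, smul_eq_mul]
  congr 1
  set T := (((List.finRange r).take (σ.symm i : ℕ)).map fun k => z k * y (σ k) * z' k).prod
  set D := (((List.finRange r).drop ((σ.symm i : ℕ) + 1)).map fun k => z k * y (σ k) * z' k).prod
  have h1 : T * (z (σ.symm i) * w * z' (σ.symm i)) * D =
      (T * z (σ.symm i)) * (w * (z' (σ.symm i) * D)) := by simp only [mul_assoc]
  rw [h1, Matrix.trace_mul_comm]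
  simp only [mul_assoc]

/-- Razmyslov's central polynomial, which multiplies the trace of `u` by a scalar function of the
other arguments. -/
lemma sum_mul_mul_capelliGradient (π : Fin r ≃ Fin n × Fin n) (z z' y : Fin r → 𝕄) (u : 𝕄) :
    ∑ i, y i * u * capelliGradient z z' y i = (capelliForm z z' y * u.trace) • (1 : 𝕄) := by
  -- Cramer's rule applied to `w = E_ab`: under the trace form, the gradients are `capelliForm z z'
  -- y` times the basis dual to `y`.
  have hC : ∀ a b c d, ∑ i, y i c d * capelliGradient z z' y i b a =
      capelliForm z z' y * (Matrix.single a b (1 : F) : 𝕄) c d := by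
    intro a b c d
    have h := congrFun (congrFun (AlternatingMap.smul_eq_sum_update_smul
      ((Matrix.stdBasis F (Fin n) (Fin n)).reindex π.symm) (capelliForm z z') y
      (Matrix.single a b 1)) c) d
    simp only [capelliForm_update, Matrix.trace_single_mul, Matrix.smul_apply, Matrix.sum_apply,
      smul_eq_mul, one_mul] at h
    rw [h]
    exact Finset.sum_congr rfl fun i _ => mul_comm _ _
  ext c d
  rw [Matrix.sum_apply]
  simp only [Matrix.mul_apply, Finset.sum_mul]
  rw [Finset.sum_comm]
  have h1 : ∀ f, ∑ i, ∑ e, y i c e * u e f * capelliGradient z z' y i f d =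
      ∑ e, u e f * (capelliForm z z' y * (Matrix.single d f (1 : F) : 𝕄) c e) := by
    intro f
    rw [Finset.sum_comm]
    refine Finset.sum_congr rfl fun e _ => ?_
    rw [← hC, Finset.mul_sum]
    exact Finset.sum_congr rfl fun i _ => by ring
  simp only [h1, Matrix.smul_apply, Matrix.trace, Matrix.diag_apply, smul_eq_mul, Matrix.one_apply]
  by_cases hcd : c = d
  · subst hcd
    simp only [Matrix.single_apply, true_and, mul_ite, mul_one, mul_zero, Finset.sum_ite_eq,
      Finset.mem_univ, if_true, Finset.mul_sum]
    exact Finset.sum_congr rfl fun _ _ => mul_comm _ _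
  · simp [hcd, Ne.symm hcd]

/-- With `y` the matrix units, `z` and `z'` are chosen so that every factor is `E₀₀` for the
identity permutation, while any other permutation produces a zero factor. -/
lemma exists_capelliForm_ne_zero [NeZero n] (π : Fin r ≃ Fin n × Fin n) :
    ∃ z z' y : Fin r → 𝕄, capelliForm z z' y ≠ 0 := by
  refine ⟨fun k => Matrix.single 0 (π k).1 1, fun k => Matrix.single (π k).2 0 1,
    fun k => Matrix.single (π k).1 (π k).2 1, ?_⟩
  have hr : r ≠ 0 := by
    rintro rfl
    exact (π.symm (0, 0)).elim0
  rw [capelliForm_apply, Finset.sum_eq_single (1 : Equiv.Perm (Fin r))]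
  · have h : (List.ofFn fun k => (Matrix.single 0 (π k).1 1 : 𝕄) *
        Matrix.single (π ((1 : Equiv.Perm (Fin r)) k)).1 (π ((1 : Equiv.Perm (Fin r)) k)).2 1 *
        Matrix.single (π k).2 0 1) = List.replicate r (Matrix.single 0 0 (1 : F) : 𝕄) := by
      rw [← List.ofFn_const]
      congr 1
      funext k
      simp
    have hid : IsIdempotentElem (Matrix.single 0 0 (1 : F) : 𝕄) := by
      simp [IsIdempotentElem]
    rw [h, List.prod_replicate, hid.pow_eq hr]
    simp
  · intro σ _ hσ
    obtain ⟨k, hk⟩ : ∃ k, σ k ≠ k := by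
      by_contra! h
      exact hσ (Equiv.ext h)
    rw [List.prod_eq_zero, Matrix.trace_zero, smul_zero]
    rw [List.mem_ofFn]
    refine ⟨k, ?_⟩
    have hπ : π k ≠ π (σ k) := fun h => hk (π.injective h).symm
    by_cases h1 : (π k).1 = (π (σ k)).1
    · have h2 : (π (σ k)).2 ≠ (π k).2 := fun h => hπ (Prod.ext h1 h.symm)
      rw [h1, Matrix.single_mul_single_same, Matrix.single_mul_single_of_ne _ _ _ _ h2]
    · rw [Matrix.single_mul_single_of_ne _ _ _ _ h1, zero_mul]
  · simp

/-- The degree is that of a full word, `3 * r`, less the one deleted `y`. -/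
lemma isHomFun_capelliGradient {m : ℕ} {z z' y : Fin r → (Fin m → 𝕄) → 𝕄}
    (hz : ∀ k, IsHomFun 1 (z k)) (hz' : ∀ k, IsHomFun 1 (z' k)) (hy : ∀ k, IsHomFun 1 (y k))
    (i : Fin r) : IsHomFun (3 * r - 1) fun a =>
      capelliGradient (fun k => z k a) (fun k => z' k a) (fun k => y k a) i := by
  have h3 : ∀ (σ : Equiv.Perm (Fin r)) (k : Fin r),
      IsHomFun 3 fun a => z k a * y (σ k) a * z' k a := by
    intro σ k
    have h := ((hz k).mul (hy (σ k))).mul (hz' k)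
    exact h
  simp only [capelliGradient]
  refine IsHomFun.sum _ fun σ _ => IsHomFun.smul _ ?_
  have h := (((hz' (σ.symm i)).mul (IsHomFun.list_prod
    ((List.finRange r).drop ((σ.symm i : ℕ) + 1)) (h3 σ))).mul (IsHomFun.list_prod
    ((List.finRange r).take (σ.symm i : ℕ)) (h3 σ))).mul (hz (σ.symm i))
  refine h.congr_deg ?_
  rw [List.length_drop, List.length_take, List.length_finRange]
  have := (σ.symm i).2
  omega

end Razmyslov

/-! ### From traces to central polynomials -/

section TraceFunctions

variable {F : Type*} [Field F] {n m : ℕ}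

/-- After multiplication by a power of the scalar function `κ` of degree `D`, the scalar function
`φ` of the matrix `x` becomes a central homogeneous noncommutative polynomial, of degree `d` in
excess of that of the power of `κ`. -/
def IsCentralFun (κ : (Fin m → Matrix (Fin n) (Fin n) F) → F) (D : ℕ) (x : (Fin m → Matrix (Fin n) (Fin n) F) → Matrix (Fin n) (Fin n) F) (d : ℕ) (φ : Matrix (Fin n) (Fin n) F → F) : Prop :=
  ∃ N, IsHomFun (N * D + d) fun a => (κ a ^ N * φ (x a)) • (1 : Matrix (Fin n) (Fin n) F)

/-- Multiplication by `κ` turns traces of homogeneous polynomials into central polynomials. -/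
def IsTraceMultiplier (κ : (Fin m → Matrix (Fin n) (Fin n) F) → F) (D : ℕ) : Prop :=
  ∀ (d : ℕ) (u : (Fin m → Matrix (Fin n) (Fin n) F) → Matrix (Fin n) (Fin n) F), IsHomFun d u →
    IsHomFun (D + d) fun a => (κ a * (u a).trace) • (1 : Matrix (Fin n) (Fin n) F)

namespace IsCentralFun

variable {κ : (Fin m → Matrix (Fin n) (Fin n) F) → F} {D : ℕ} {x : (Fin m → Matrix (Fin n) (Fin n) F) → Matrix (Fin n) (Fin n) F} {d e : ℕ} {φ ψ : Matrix (Fin n) (Fin n) F → F}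

lemma congr_deg (h : IsCentralFun κ D x d φ) (hd : d = e) : IsCentralFun κ D x e φ := hd ▸ h

lemma const (c : F) : IsCentralFun κ D x 0 fun _ => c := by
  refine ⟨0, ?_⟩
  simpa using IsHomFun.one.smul c

lemma zero : IsCentralFun κ D x d fun _ => 0 := by
  refine ⟨0, ?_⟩
  simpa using IsHomFun.zero

lemma smul (c : F) (h : IsCentralFun κ D x d φ) : IsCentralFun κ D x d fun A => c * φ A := by
  obtain ⟨N, hN⟩ := h
  refine ⟨N, ?_⟩
  have h := hN.smul c
  simp only [smul_smul] at h
  simpa only [mul_left_comm] using h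

lemma mul (hφ : IsCentralFun κ D x d φ) (hψ : IsCentralFun κ D x e ψ) :
    IsCentralFun κ D x (d + e) fun A => φ A * ψ A := by
  obtain ⟨N, hN⟩ := hφ
  obtain ⟨N', hN'⟩ := hψ
  refine ⟨N + N', ?_⟩
  have h := (hN.mul hN').congr_deg (show _ = (N + N') * D + (d + e) by ring)
  simp only [smul_mul_smul_comm, mul_one] at h
  convert h using 3
  ring

lemma pow (h : IsCentralFun κ D x d φ) (k : ℕ) : IsCentralFun κ D x (k * d) fun A => φ A ^ k := by
  induction k with
  | zero => simpa using const 1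
  | succ k ih =>
    simp only [pow_succ]
    exact (ih.mul h).congr_deg (by ring)

lemma prod {ι : Type*} (s : Finset ι) {d : ι → ℕ} {φ : ι → Matrix (Fin n) (Fin n) F → F}
    (h : ∀ i ∈ s, IsCentralFun κ D x (d i) (φ i)) :
    IsCentralFun κ D x (∑ i ∈ s, d i) fun A => ∏ i ∈ s, φ i A := by
  classical
  induction s using Finset.induction_on with
  | empty => simpa using const 1
  | insert i s hi ih =>
    simp only [Finset.prod_insert hi, Finset.sum_insert hi]
    exact (h i (Finset.mem_insert_self _ _)).mul
      (ih fun j hj => h j (Finset.mem_insert_of_mem hj))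

lemma trace_pow (hκ : IsTraceMultiplier κ D) (hx : IsHomFun 1 x) (k : ℕ) :
    IsCentralFun κ D x k fun A => (A ^ k).trace := by
  refine ⟨1, ?_⟩
  have h := hκ _ _ (hx.pow k)
  simp only [mul_one] at h
  simpa only [pow_one, one_mul] using h

variable [CharZero F] [NeZero n]

/-- The exponent can be raised: a scalar matrix is `1 / n` times its trace, and taking a trace costs
one factor `κ`. This allows sums with a common power of `κ`. -/
lemma exists_forall_le (hκ : IsTraceMultiplier κ D) (h : IsCentralFun κ D x d φ) :
    ∃ N₀, ∀ N, N₀ ≤ N → IsHomFun (N * D + d) fun a => (κ a ^ N * φ (x a)) • (1 : Matrix (Fin n) (Fin n) F) := by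
  obtain ⟨N₀, hN₀⟩ := h
  refine ⟨N₀, fun N hN => ?_⟩
  induction N, hN using Nat.le_induction with
  | base => exact hN₀
  | succ N hN ih =>
    have h := ((hκ _ _ ih).smul (n : F)⁻¹).congr_deg (show _ = (N + 1) * D + d by ring)
    convert h using 2 with a
    have hn : (n : F) ≠ 0 := Nat.cast_ne_zero.2 (NeZero.ne n)
    rw [Matrix.trace_smul, Matrix.trace_one, Fintype.card_fin, smul_smul, smul_eq_mul]
    congr 1
    field_simp
    ring

lemma add (hκ : IsTraceMultiplier κ D) (hφ : IsCentralFun κ D x d φ)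
    (hψ : IsCentralFun κ D x d ψ) : IsCentralFun κ D x d fun A => φ A + ψ A := by
  obtain ⟨N, hN⟩ := hφ.exists_forall_le hκ
  obtain ⟨N', hN'⟩ := hψ.exists_forall_le hκ
  refine ⟨max N N', ?_⟩
  have h := (hN _ (le_max_left N N')).add (hN' _ (le_max_right N N'))
  simpa only [← add_smul, ← mul_add] using h

lemma sum (hκ : IsTraceMultiplier κ D) {ι : Type*} (s : Finset ι) {φ : ι → Matrix (Fin n) (Fin n) F → F}
    (h : ∀ i ∈ s, IsCentralFun κ D x d (φ i)) :
    IsCentralFun κ D x d fun A => ∑ i ∈ s, φ i A := by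
  classical
  induction s using Finset.induction_on with
  | empty => simpa using zero
  | insert i s hi ih =>
    simp only [Finset.sum_insert hi]
    exact (h i (Finset.mem_insert_self _ _)).add hκ
      (ih fun j hj => h j (Finset.mem_insert_of_mem hj))

/-- Newton's identity divided by `k` expresses the coefficient through those of higher index, which
have smaller `k`. -/
lemma charpoly_coeff (hκ : IsTraceMultiplier κ D) (hx : IsHomFun 1 x) (k : ℕ) :
    ∀ j, j + k = n → IsCentralFun κ D x k fun A => A.charpoly.coeff j := by
  induction k using Nat.strong_induction_on with
  | _ k ih =>
  intro j hj
  rcases Nat.eq_zero_or_pos k with rfl | hk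
  · have h : ∀ A : Matrix (Fin n) (Fin n) F, A.charpoly.coeff j = 1 := by
      intro A
      have := A.charpoly_monic.coeff_natDegree
      rw [Matrix.charpoly_natDegree_eq_dim, Fintype.card_fin] at this
      rwa [show j = n by omega]
    simp only [h]
    exact const 1
  · have hk0 : (k : F) ≠ 0 := Nat.cast_ne_zero.2 hk.ne'
    have h : ∀ A : Matrix (Fin n) (Fin n) F, A.charpoly.coeff j = -(k : F)⁻¹ * ∑ i ∈ Finset.range n,
        A.charpoly.coeff (j + i + 1) * (A ^ (i + 1)).trace := by
      intro A
      have h := card_sub_mul_charpoly_coeff A j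
      have hnk : (n : F) - j = k := by
        rw [← hj]
        push_cast
        ring
      rw [Fintype.card_fin, hnk] at h
      rw [neg_mul, ← mul_neg, ← h, inv_mul_cancel_left₀ hk0]
    simp only [h]
    refine smul _ (sum hκ _ fun i _ => ?_)
    by_cases hi : i + 1 ≤ k
    · exact ((ih (k - (i + 1)) (by omega) (j + i + 1) (by omega)).mul
        (trace_pow hκ hx (i + 1))).congr_deg (by omega)
    · have h0 : ∀ A : Matrix (Fin n) (Fin n) F, A.charpoly.coeff (j + i + 1) = 0 := by
        intro A
        apply Polynomial.coeff_eq_zero_of_natDegree_lt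
        rw [Matrix.charpoly_natDegree_eq_dim, Fintype.card_fin]
        omega
      simp only [h0, zero_mul]
      exact zero

end IsCentralFun

lemma Matrix.charpoly_smul_coeff {R : Type*} [CommRing R] (c : R) (A : Matrix (Fin n) (Fin n) R)
    {k : ℕ} (hk : k ≤ n) :
    (c • A).charpoly.coeff (n - k) = c ^ k * A.charpoly.coeff (n - k) := by
  have h := fun B : Matrix (Fin n) (Fin n) R =>
    Matrix.charpoly_coeff_eq_sum_minors B k (by rwa [Fintype.card_fin])
  rw [Fintype.card_fin] at h
  rw [h, h, mul_left_comm]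
  congr 1
  rw [Finset.mul_sum]
  refine Finset.sum_congr rfl fun s hs => ?_
  have hdet := Matrix.det_smul (A.submatrix (Subtype.val : s → Fin n) Subtype.val) c
  rw [Fintype.card_coe, (Finset.mem_powersetCard.1 hs).2] at hdet
  exact hdet

/-- Sums need a common degree. Giving the `i`-th characteristic coefficient weight `n - i`,
homogeneity of `p` allows all monomials of weight other than `k` to be dropped. -/
lemma IsCentralFun.entryEval [CharZero F] [IsAlgClosed F] [NeZero n] {κ : (Fin m → Matrix (Fin n) (Fin n) F) → F}
    {D : ℕ} {x : (Fin m → Matrix (Fin n) (Fin n) F) → Matrix (Fin n) (Fin n) F} (hκ : IsTraceMultiplier κ D) (hx : IsHomFun 1 x)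
    {p : MvPolynomial (Fin n × Fin n) F} (hp : ClosedUnderConj (matrixD p)) {k : ℕ}
    (hk : p.IsHomogeneous k) : IsCentralFun κ D x k (entryEval p) := by
  obtain ⟨q, hq⟩ := exists_entryEval_eq_eval_charpoly_coeff hp
  let wt : (Fin n →₀ ℕ) → ℕ := fun μ => ∑ i ∈ μ.support, μ i * (n - i)
  let T : (Fin n →₀ ℕ) → Matrix (Fin n) (Fin n) F → F := fun μ A =>
    q.coeff μ * ∏ i ∈ μ.support, A.charpoly.coeff i ^ μ i
  have hpT : ∀ A, _root_.entryEval p A = ∑ μ ∈ q.support, T μ A := fun A => by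
    rw [hq, MvPolynomial.eval_eq]
  have hTsmul : ∀ μ c A, T μ (c • A) = T μ A * c ^ wt μ := by
    intro μ c A
    simp only [T, wt]
    have h : ∀ i : Fin n, (c • A).charpoly.coeff i = c ^ (n - i : ℕ) * A.charpoly.coeff i := by
      intro i
      have := Matrix.charpoly_smul_coeff c A (Nat.sub_le n i)
      rwa [Nat.sub_sub_self i.2.le] at this
    simp only [h, mul_pow, Finset.prod_mul_distrib, ← pow_mul, Finset.prod_pow_eq_pow_sum]
    simp only [mul_comm (n - _)]
    ring
  have hpart : ∀ A, _root_.entryEval p A = ∑ μ ∈ q.support with wt μ = k, T μ A := by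
    intro A
    have hpoly : ∑ μ ∈ q.support, Polynomial.C (T μ A) * Polynomial.X ^ wt μ =
        Polynomial.C (_root_.entryEval p A) * Polynomial.X ^ k := by
      apply Polynomial.funext
      intro c
      have h : _root_.entryEval p (c • A) = c ^ k * _root_.entryEval p A :=
        hk.eval_const_mul c _
      rw [Polynomial.eval_finsetSum]
      simp only [Polynomial.eval_mul, Polynomial.eval_C, Polynomial.eval_pow, Polynomial.eval_X,
        ← hTsmul]
      rw [← hpT, h, mul_comm]
    have h := congrArg (fun f => Polynomial.coeff f k) hpoly
    simp only [Polynomial.finsetSum_coeff, Polynomial.coeff_C_mul_X_pow, if_true] at h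
    rw [← h, Finset.sum_filter]
    exact Finset.sum_congr rfl fun μ _ => by simp only [eq_comm]
  have hfun : _root_.entryEval p = fun A => ∑ μ ∈ q.support with wt μ = k, T μ A := funext hpart
  rw [hfun]
  refine IsCentralFun.sum hκ _ fun μ hμ => IsCentralFun.smul _ ?_
  refine (IsCentralFun.prod _ fun (i : Fin n) _ =>
    (IsCentralFun.charpoly_coeff hκ hx (n - i) i (by have := i.2; omega)).pow (μ i)).congr_deg ?_
  exact (Finset.mem_filter.1 hμ).2

end TraceFunctions

/-! ### The multiplier and the final polynomial -/

/-- There are a nonzero trace multiplier and a variable on which it does not depend. -/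
lemma exists_isTraceMultiplier (F : Type*) [Field F] (n : ℕ) [NeZero n] :
    ∃ (m D : ℕ) (i₀ : Fin m) (κ : (Fin m → Matrix (Fin n) (Fin n) F) → F)
      (b : Fin m → Matrix (Fin n) (Fin n) F),
      IsTraceMultiplier κ D ∧ ∃ w, w ≠ 0 ∧ ∀ A, κ (Function.update b i₀ A) = w := by
  obtain ⟨z, z', y, h0⟩ := exists_capelliForm_ne_zero (F := F) (finProdFinEquiv (m := n) (n := n)).symm
  -- `none` indexes the free variable `x`; the other indices carry the three Capelli families.
  let ι := Option (Fin 3 × Fin (n * n))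
  let e : ι ≃ Fin (Fintype.card ι) := Fintype.equivFin ι
  let c : ι → Matrix (Fin n) (Fin n) F := fun i => i.elim 0 fun jk => ![z, z', y] jk.1 jk.2
  let v : Fin 3 → Fin (n * n) → Fin (Fintype.card ι) := fun j k => e (some (j, k))
  have hn : 0 < n * n := Nat.mul_pos (Nat.pos_of_neZero n) (Nat.pos_of_neZero n)
  refine ⟨Fintype.card ι, 3 * (n * n), e none,
    fun a => capelliForm (fun k => a (v 0 k)) (fun k => a (v 1 k)) (fun k => a (v 2 k)),
    fun i => c (e.symm i), ?_, _, h0, ?_⟩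
  · intro d u hu
    simp only [← sum_mul_mul_capelliGradient (finProdFinEquiv (m := n) (n := n)).symm]
    refine IsHomFun.sum _ fun i _ => ?_
    have hQ := isHomFun_capelliGradient (F := F) (n := n) (fun k => IsHomFun.var (v 0 k))
      (fun k => IsHomFun.var (v 1 k)) (fun k => IsHomFun.var (v 2 k)) i
    exact (((IsHomFun.var (v 2 i)).mul hu).mul hQ).congr_deg (by omega)
  · intro A
    have hv : ∀ j k, Function.update (fun i => c (e.symm i)) (e none) A (v j k) =
        ![z, z', y] j k := by
      intro j k
      rw [Function.update_of_ne (e.injective.ne (by simp))]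
      simp [c]
    simp only [hv]
    rfl

theorem theorem4p5 {F : Type*} [Field F] [IsAlgClosed F] [CharZero F] (n : ℕ)
    (p : MvPolynomial (Fin n × Fin n) F) (U : Set (Matrix (Fin n) (Fin n) F))
    (hU : U = matrixD p) (hconj : ClosedUnderConj U) (hsmul : ClosedUnderNonzeroSMul U) :
    ∃ (m d : ℕ) (f : FreeAlgebra F (Fin m)), NCHomogeneous d f ∧ ncImage n f = U ∪ {0} := by
  subst hU
  by_cases htriv : n = 0 ∨ p = 0
  -- In both degenerate cases `U ∪ {0}` is `{0}`, the image of the zero polynomial.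
  · refine ⟨0, 0, 0, Submodule.zero_mem _, ?_⟩
    ext A
    simp only [ncImage, map_zero, Set.range_const, Set.mem_singleton_iff, Set.mem_union]
    rcases htriv with rfl | rfl
    · simp [Subsingleton.elim A 0]
    · simp [matrixD]
  push Not at htriv
  obtain ⟨hn, hp0⟩ := htriv
  have : NeZero n := ⟨hn⟩
  obtain ⟨k, hk⟩ := exists_isHomogeneous_of_closedUnderNonzeroSMul hsmul hp0
  obtain ⟨m, D, i₀, κ, b, hκ, w, hw, hb⟩ := exists_isTraceMultiplier F n
  obtain ⟨N, hN⟩ := IsCentralFun.entryEval hκ (IsHomFun.var i₀) hconj hk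
  obtain ⟨f, hf, hfa⟩ := hN.mul (IsHomFun.var i₀)
  refine ⟨m, _, f, hf, ?_⟩
  simp only [smul_mul_assoc, one_mul] at hfa
  ext A
  simp only [ncImage, hfa, Set.mem_range, Set.mem_union, Set.mem_singleton_iff]
  constructor
  · rintro ⟨a, rfl⟩
    by_cases h : κ a ^ N * entryEval p (a i₀) = 0
    · right
      rw [h, zero_smul]
    · exact Or.inl (hsmul _ h _ (right_ne_zero_of_mul h))
  · rintro (hA | rfl)
    · have hA' : entryEval p A ≠ 0 := hA
      -- The exponent is `k + 1`: `k` from `p (c • A)` and one from the factor `x`.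
      obtain ⟨c, hc⟩ := IsAlgClosed.exists_pow_nat_eq (w ^ N * entryEval p A)⁻¹ k.succ_pos
      refine ⟨Function.update b i₀ (c • A), ?_⟩
      have hcA : entryEval p (c • A) = c ^ k * entryEval p A := hk.eval_const_mul c _
      have h1 : w ^ N * (c ^ k * entryEval p A) * c = c ^ k.succ * (w ^ N * entryEval p A) := by
        rw [pow_succ]
        ring
      rw [hb, Function.update_self, hcA, smul_smul, h1, hc,
        inv_mul_cancel₀ (mul_ne_zero (pow_ne_zero _ hw) hA'), one_smul]
    · exact ⟨Function.update b i₀ 0, by rw [Function.update_self, smul_zero]⟩
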